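/- Let $X$ be a random variable with values in a measurable space $\mathcal{X}$, let $\mathcal{T}\subseteq\mathbb{R}^k$ be compact, and let $\hat\theta\colon\mathcal{X}\times\mathcal{T}\to\mathbb{R}$ be such that $\hat\theta(\cdot,t)$ is measurable for every $t\in\mathcal{T}$, $\hat\theta(x,\cdot)$ is continuous for every $x\in\mathcal{X}$, and $\sup_{x,t}|\hat\theta(x,t)|<+\infty$. Put $\theta(t):=E(\hat\theta(X,t))$ and assume that $\theta$ has a minimum $\theta_*:=\min_{t\in\mathcal{T}}\theta(t)$. Let $\tau\colon\mathcal{X}\to\mathcal{T}$ be a measurable function with $\tau(x)\in\arg\min_{t\in\mathcal{T}}\hat\theta(x,t)$ for all $x\in\mathcal{X}$, and let $$\hat\theta_*(x):=\hat\theta(x,\tau(x))=\min_{t\in\mathcal{T}}\hat\theta(x,t),\qquad \hat\theta^*(x,x'):=\hat\theta(x,\tau(x')).$$ Let $\alpha\in(0,1)$. For $\chi_1,\dots,\chi_N,\chi'_1,\dots,\chi'_N$ independent and identically distributed with the law of $X$ (on any probability space), let $\bar Y_*$ and $S_*$ be the sample mean and the sample standard deviation (with divisor $N-1$ in the sample variance)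 of $(\hat\theta_*(\chi_i))_{i=1}^N$, let $\bar Y^*$ and $S^*$ be those of $(\hat\theta^*(\chi_i,\chi'_i))_{i=1}^N$, and let $t_{N-1}$ be the two-sided critical value of Student's t-distribution with $N-1$ degrees of freedom at confidence level $1-\alpha$, that is, $P(|T|\le t_{N-1})=1-\alpha$ for $T$ with that distribution. Then $\left[\bar Y_*-t_{N-1}\frac{S_*}{\sqrt N},\ \bar Y^*+t_{N-1}\frac{S^*}{\sqrt N}\right]$ is an approximate confidence interval for $\theta_*$ with confidence level at least $1-\alpha$, in the sense that for every $\varepsilon>0$ there is an $N_0$ such that for all $N\ge N_0$ and all such $\chi_1,\dots,\chi_N,\chi'_1,\dots,\chi'_N$, $$P\left(\bar Y_*-t_{N-1}\frac{S_*}{\sqrt N}\le\theta_*\le\bar Y^*+t_{N-1}\frac{S^*}{\sqrt N}\right)\ \ge\ 1-\alpha-\varepsilon .$$ Equivalently, the limit inferior of this probability as $N\to\infty$ is at least $1-\alpha$. -/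

import Mathlib

open MeasureTheory ProbabilityTheory

noncomputable section

/-- The sample mean of `y 0, …, y (N - 1)`. -/
def sampleMean {N : ℕ} (y : Fin N → ℝ) : ℝ :=
  (∑ i, y i) / N

/-- The sample standard deviation, with Bessel's correction `N - 1`. -/
def sampleStdDev {N : ℕ} (y : Fin N → ℝ) : ℝ :=
  √((∑ i, (y i - sampleMean y) ^ 2) / ((N : ℝ) - 1))

/-- Student's t-distribution with `ν ≥ 1` degrees of freedom: the law of
`Z₀ / √((Z₁² + ⋯ + Z_ν²) / ν)` for independent standard normal `Z₀, …, Z_ν`. -/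
def studentT (ν : ℕ) : Measure ℝ :=
  (Measure.pi fun _ : Fin (ν + 1) => gaussianReal 0 1).map
    fun z => z 0 / √((∑ i : Fin ν, z i.succ ^ 2) / ν)

/-- The two-sided critical value of the t-distribution with `ν` degrees of freedom at
confidence level `1 - α`: the `c ≥ 0` with `P(|T| ≤ c) = 1 - α`, obtained as the least `c ≥ 0`
with `P(|T| ≤ c) ≥ 1 - α`. -/
def tCritical (ν : ℕ) (α : ℝ) : ℝ :=
  sInf {c : ℝ | 0 ≤ c ∧ 1 - α ≤ (studentT ν).real (Set.Icc (-c) c)}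

/-- The lower estimator `θ̂(x, τ(x))`, which is `min_t θ̂(x, t)` when `τ(x)` is a minimiser
of `θ̂(x, ·)`. -/
def lowerEstimator {𝒳 T : Type*} (θhat : 𝒳 → T → ℝ) (τ : 𝒳 → T) (x : 𝒳) : ℝ :=
  θhat x (τ x)

/-- The upper estimator `θ̂(x, τ(x'))`. -/
def upperEstimator {𝒳 T : Type*} (θhat : 𝒳 → T → ℝ) (τ : 𝒳 → T) (x x' : 𝒳) : ℝ :=
  θhat x (τ x')

/-- The lower end point `ȳ - t_{N-1} s / √N`. -/
def lowerConfidenceLimit {N : ℕ} (α : ℝ) (y : Fin N → ℝ) : ℝ :=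
  sampleMean y - tCritical (N - 1) α * (sampleStdDev y / √N)

/-- The upper end point `ȳ + t_{N-1} s / √N`. -/
def upperConfidenceLimit {N : ℕ} (α : ℝ) (y : Fin N → ℝ) : ℝ :=
  sampleMean y + tCritical (N - 1) α * (sampleStdDev y / √N)

end

/-!
Each one-sided t-interval misses the mean of a square-integrable law with asymptotic probability at
most `α / 2`. Indeed, by the central limit theorem, the strong law for the sample standard deviation
and Slutsky's lemma, `√N (ȳ - m) - c s` converges in distribution to `σ (Z - c)`; the law of large
numbers for the chi-square denominators shows that the t-distributions converge to the standard
normal one, so that their critical values eventually exceed every `c` with `P(|Z| ≤ c) < 1 - α`. If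
`σ = 0`, the interval is almost surely the single point `m`.

Since `τ(x)` minimises `θ̂(x, ·)`, the lower estimator has mean at most `θ(t)` for every `t`; since
`τ(χ')` is independent of `χ`, Fubini shows that the upper estimator has mean at least `θ_*`. A
union bound combines the two one-sided errors.
-/

open Filter Topology

section SymmetricIntervals

variable {μ : Measure ℝ} [IsProbabilityMeasure μ]

theorem tendsto_measureReal_Icc_neg_atTop (μ : Measure ℝ) [IsProbabilityMeasure μ] :
    Tendsto (fun c : ℝ => μ.real (Set.Icc (-c) c)) atTop (𝓝 1) := by
  have hmono : Monotone fun c : ℝ => Set.Icc (-c) c := fun a b hab =>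
    Set.Icc_subset_Icc (neg_le_neg hab) hab
  have hunion : ⋃ c : ℝ, Set.Icc (-c) c = Set.univ :=
    Set.eq_univ_of_forall fun x => Set.mem_iUnion.2 ⟨|x|, neg_abs_le x, le_abs_self x⟩
  have hlim := tendsto_measure_iUnion_atTop (μ := μ) hmono
  rw [hunion, measure_univ] at hlim
  exact (ENNReal.tendsto_toReal ENNReal.one_ne_top).comp hlim

theorem exists_measureReal_Icc_neg_eq [NullSingletonClass μ] {p : ℝ} (hp₀ : 0 ≤ p)
    (hp₁ : p < 1) : ∃ c : ℝ, 0 ≤ c ∧ μ.real (Set.Icc (-c) c) = p := by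
  have hcont : ContinuousOn (fun c : ℝ => μ.real (Set.Icc (-c) c)) (Set.Ici 0) := by
    have hint : ∀ a b : ℝ, IntervalIntegrable (fun _ => (1 : ℝ)) μ a b := fun a b =>
      intervalIntegrable_const
    have hprim : Continuous fun b : ℝ => ∫ _ in (0 : ℝ)..b, (1 : ℝ) ∂μ :=
      intervalIntegral.continuous_primitive hint 0
    refine (hprim.sub (hprim.comp continuous_neg)).continuousOn.congr fun c (hc : 0 ≤ c) => ?_
    rw [Pi.sub_apply, Function.comp_apply,
      intervalIntegral.integral_interval_sub_left (hint _ _) (hint _ _),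
      intervalIntegral.integral_of_le (by linarith), integral_const, smul_eq_mul, mul_one,
      measureReal_restrict_apply_univ, measureReal_congr Ioc_ae_eq_Icc]
  obtain ⟨b, hpb, hb⟩ := (((tendsto_measureReal_Icc_neg_atTop μ).eventually_const_lt hp₁).and
    (eventually_ge_atTop 0)).exists
  have hzero : μ.real (Set.Icc (-0) 0) = 0 := by simp [measureReal_def]
  obtain ⟨c, hc, hcp⟩ := intermediate_value_Icc hb (hcont.mono Set.Icc_subset_Ici_self)
    ⟨hzero.le.trans hp₀, hpb.le⟩
  exact ⟨c, hc.1, hcp⟩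

theorem measureReal_Ici_eq_of_map_neg_eq [NullSingletonClass μ]
    (hμ : μ.map (fun x => -x) = μ) {c : ℝ} (hc : 0 ≤ c) :
    μ.real (Set.Ici c) = (1 - μ.real (Set.Icc (-c) c)) / 2 := by
  have hsymm : μ.real (Set.Iio (-c)) = μ.real (Set.Ioi c) := by
    nth_rw 1 [← hμ]
    rw [map_measureReal_apply measurable_neg measurableSet_Iio]
    congr 1
    ext x
    simp
  have hIci : μ.real (Set.Ici c) = μ.real (Set.Ioi c) := measureReal_congr Ioi_ae_eq_Ici.symm
  have hcompl : (Set.Icc (-c) c)ᶜ = Set.Iio (-c) ∪ Set.Ioi c := by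
    rw [← Set.Ici_inter_Iic, Set.compl_inter, Set.compl_Ici, Set.compl_Iic]
  have hdisj : Disjoint (Set.Iio (-c)) (Set.Ioi c) :=
    (Set.Iio_disjoint_Ici (by linarith)).mono_right Set.Ioi_subset_Ici_self
  have htotal := probReal_compl_eq_one_sub (μ := μ) (measurableSet_Icc (a := -c) (b := c))
  rw [hcompl, measureReal_union hdisj measurableSet_Ioi, hsymm] at htotal
  linarith

end SymmetricIntervals

theorem eventually_measureReal_lt_of_tendsto_of_isClosed {E ι : Type*} [MeasurableSpace E]
    [TopologicalSpace E] [OpensMeasurableSpace E] [HasOuterApproxClosed E] {l : Filter ι}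
    {μs : ι → ProbabilityMeasure E} {μ : ProbabilityMeasure E} (hμs : Tendsto μs l (𝓝 μ))
    {F : Set E} (hF : IsClosed F) {r : ℝ} (hr : (μ : Measure E).real F < r) :
    ∀ᶠ i in l, (μs i : Measure E).real F < r := by
  have hlt : (μ : Measure E) F < ENNReal.ofReal r := by
    rwa [← ofReal_measureReal, ENNReal.ofReal_lt_ofReal_iff (measureReal_nonneg.trans_lt hr)]
  have hlimsup := ProbabilityMeasure.limsup_measure_closed_le_of_tendsto hμs hF
  filter_upwards [eventually_lt_of_limsup_lt (hlimsup.trans_lt hlt)] with i hi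
  exact (ENNReal.lt_ofReal_iff_toReal_lt hi.ne_top).1 hi

section SampleStatistics

variable {N : ℕ}

@[fun_prop]
theorem measurable_sampleMean : Measurable (sampleMean (N := N)) := by
  unfold sampleMean
  fun_prop

@[fun_prop]
theorem measurable_sampleStdDev : Measurable (sampleStdDev (N := N)) := by
  unfold sampleStdDev
  fun_prop

@[fun_prop]
theorem measurable_lowerConfidenceLimit (α : ℝ) :
    Measurable (lowerConfidenceLimit (N := N) α) := by
  unfold lowerConfidenceLimit
  fun_prop

theorem sampleMean_neg (y : Fin N → ℝ) : sampleMean (fun i => -y i) = -sampleMean y := by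
  simp only [sampleMean, Finset.sum_neg_distrib, neg_div]

theorem sampleStdDev_neg (y : Fin N → ℝ) : sampleStdDev (fun i => -y i) = sampleStdDev y := by
  simp only [sampleStdDev, sampleMean_neg, neg_sub_neg, sub_sq_comm (sampleMean y)]

theorem lowerConfidenceLimit_neg (α : ℝ) (y : Fin N → ℝ) :
    lowerConfidenceLimit α (fun i => -y i) = -upperConfidenceLimit α y := by
  rw [lowerConfidenceLimit, upperConfidenceLimit, sampleMean_neg, sampleStdDev_neg]
  ring

theorem natCast_mul_sampleMean (y : Fin N → ℝ) : N * sampleMean y = ∑ i, y i := by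
  rcases N.eq_zero_or_pos with rfl | hN
  · simp
  · exact mul_div_cancel₀ _ (by positivity)

theorem sum_sub_sampleMean_sq (y : Fin N → ℝ) :
    ∑ i, (y i - sampleMean y) ^ 2 =
      N * (sampleMean (fun i => y i ^ 2) - sampleMean y ^ 2) := by
  simp only [sub_sq, Finset.sum_add_distrib, Finset.sum_sub_distrib, ← Finset.sum_mul,
    ← Finset.mul_sum, Finset.sum_const, Finset.card_univ, Fintype.card_fin, nsmul_eq_mul,
    ← natCast_mul_sampleMean]
  ring

theorem sampleStdDev_eq_sqrt_mul_sub_sq (y : Fin N → ℝ) :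
    sampleStdDev y =
      √(N / ((N : ℝ) - 1) * (sampleMean (fun i => y i ^ 2) - sampleMean y ^ 2)) := by
  rw [sampleStdDev, sum_sub_sampleMean_sq, mul_div_right_comm]

theorem lowerConfidenceLimit_const (hN : N ≠ 0) (α m : ℝ) :
    lowerConfidenceLimit α (fun _ : Fin N => m) = m := by
  have hmean : sampleMean (fun _ : Fin N => m) = m := by simp [sampleMean, hN]
  simp [lowerConfidenceLimit, sampleStdDev, hmean]

theorem mul_sampleStdDev_le_of_lt_lowerConfidenceLimit (hN : N ≠ 0) {α c m : ℝ}
    (hc : c ≤ tCritical (N - 1) α) {y : Fin N → ℝ} (hm : m < lowerConfidenceLimit α y) :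
    c * sampleStdDev y ≤ √N * (sampleMean y - m) := by
  have hN₀ : (0 : ℝ) < √N := by positivity
  calc c * sampleStdDev y ≤ tCritical (N - 1) α * sampleStdDev y :=
        mul_le_mul_of_nonneg_right hc (Real.sqrt_nonneg _)
    _ = √N * (tCritical (N - 1) α * (sampleStdDev y / √N)) := by field_simp
    _ ≤ √N * (sampleMean y - m) := mul_le_mul_of_nonneg_left (lt_sub_comm.1 hm).le hN₀.le

end SampleStatistics

section IID

variable {Ω Ω' : Type*} [MeasurableSpace Ω] [MeasurableSpace Ω'] {P : Measure Ω} {P' : Measure Ω'}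
  {Y : ℕ → Ω → ℝ} {Z : Ω' → ℝ}

theorem ae_tendsto_sampleMean (hint : Integrable (Y 0) P)
    (hindep : Pairwise fun i j => Y i ⟂ᵢ[P] Y j) (hident : ∀ i, IdentDistrib (Y i) (Y 0) P P) :
    ∀ᵐ ω ∂P, Tendsto (fun N => sampleMean fun i : Fin N => Y i ω) atTop (𝓝 P[Y 0]) := by
  filter_upwards [strong_law_ae_real Y hint hindep hident] with ω hω
  simpa only [sampleMean, Fin.sum_univ_eq_sum_range (fun i => Y i ω)] using hω

variable [IsProbabilityMeasure P]

theorem ae_tendsto_sampleStdDev (hL2 : MemLp (Y 0) 2 P)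
    (hindep : Pairwise fun i j => Y i ⟂ᵢ[P] Y j) (hident : ∀ i, IdentDistrib (Y i) (Y 0) P P) :
    ∀ᵐ ω ∂P, Tendsto (fun N => sampleStdDev fun i : Fin N => Y i ω) atTop
      (𝓝 √(Var[Y 0; P])) := by
  have hsq : Measurable fun x : ℝ => x ^ 2 := by fun_prop
  filter_upwards [ae_tendsto_sampleMean (hL2.integrable one_le_two) hindep hident,
    ae_tendsto_sampleMean (Y := fun i ω => Y i ω ^ 2) hL2.integrable_sq
      (fun i j hij => (hindep hij).comp hsq hsq) fun i => (hident i).comp hsq] with ω hmean hmeansq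
  have hratio : Tendsto (fun N : ℕ => (N : ℝ) / ((N : ℝ) - 1)) atTop (𝓝 1) := by
    simpa only [sub_eq_add_neg] using tendsto_natCast_div_add_atTop (-1 : ℝ)
  have hlim := (hratio.mul (hmeansq.sub (hmean.pow 2))).sqrt
  simpa only [sampleStdDev_eq_sqrt_mul_sub_sq, variance_eq_sub hL2, Pi.pow_apply, one_mul]
    using hlim

variable [IsProbabilityMeasure P']

theorem tendstoInDistribution_sqrt_mul_sampleMean_sub
    (hZ : HasLaw Z (gaussianReal 0 Var[Y 0; P].toNNReal) P') (hL2 : MemLp (Y 0) 2 P)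
    (hindep : iIndepFun Y P) (hident : ∀ i, IdentDistrib (Y i) (Y 0) P P) :
    TendstoInDistribution
      (fun (N : ℕ) ω => √N * (sampleMean (fun i : Fin N => Y i ω) - P[Y 0])) atTop Z
      (fun _ => P) P' := by
  have hclt := tendstoInDistribution_inv_sqrt_mul_sum_sub hZ hL2 hindep hident
  refine hclt.congr (fun N => ae_of_all _ fun ω => ?_) (ae_of_all _ fun _ => rfl)
  rw [← Fin.sum_univ_eq_sum_range (fun i => Y i ω), ← natCast_mul_sampleMean, ← mul_sub,
    ← mul_assoc, inv_mul_eq_div, Real.div_sqrt]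

theorem tendstoInDistribution_sqrt_mul_sampleMean_sub_sub_mul_sampleStdDev
    (hZ : HasLaw Z (gaussianReal 0 1) P') (hL2 : MemLp (Y 0) 2 P)
    (hindep : iIndepFun Y P) (hident : ∀ i, IdentDistrib (Y i) (Y 0) P P) (c : ℝ) :
    TendstoInDistribution
      (fun (N : ℕ) ω => √N * (sampleMean (fun i : Fin N => Y i ω) - P[Y 0]) -
        c * sampleStdDev fun i : Fin N => Y i ω)
      atTop (fun ω => √(Var[Y 0; P]) * Z ω - c * √(Var[Y 0; P])) (fun _ => P) P' := by
  have hmeas : ∀ i, AEMeasurable (Y i) P := fun i => (hident i).aemeasurable_fst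
  have hS : ∀ N, AEMeasurable (fun ω => sampleStdDev fun i : Fin N => Y i ω) P := fun N => by
    fun_prop
  have hlaw : HasLaw (fun ω => √(Var[Y 0; P]) * Z ω)
      (gaussianReal 0 Var[Y 0; P].toNNReal) P' := by
    convert gaussianReal_const_mul hZ √(Var[Y 0; P]) using 2
    · simp
    · ext
      simp [Real.sq_sqrt, variance_nonneg]
  exact (tendstoInDistribution_sqrt_mul_sampleMean_sub hlaw hL2 hindep hident)
    |>.continuous_comp_prodMk_of_tendstoInMeasure_const (g := fun p : ℝ × ℝ => p.1 - c * p.2)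
      (by fun_prop)
      (tendstoInMeasure_of_tendsto_ae (fun N => (hS N).aestronglyMeasurable)
        (ae_tendsto_sampleStdDev hL2 (fun i j hij => hindep.indepFun hij) hident)) hS

end IID

section StudentT

instance isProbabilityMeasure_studentT (n : ℕ) : IsProbabilityMeasure (studentT n) :=
  Measure.isProbabilityMeasure_map (by fun_prop)

theorem hasLaw_studentT {Ω : Type*} [MeasurableSpace Ω] {P : Measure Ω} {n : ℕ}
    {Z : Fin (n + 1) → Ω → ℝ} (hZ : ∀ i, HasLaw (Z i) (gaussianReal 0 1) P)
    (hindep : iIndepFun Z P) :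
    HasLaw (fun ω => Z 0 ω / √(sampleMean fun i : Fin n => Z i.succ ω ^ 2)) (studentT n) P :=
  HasLaw.comp (Y := fun z : Fin (n + 1) → ℝ => z 0 / √(sampleMean fun i : Fin n => z i.succ ^ 2))
    ⟨by fun_prop, rfl⟩ (hindep.hasLaw_pi hZ)

theorem integral_sq_gaussianReal (m : ℝ) (v : NNReal) :
    ∫ x, x ^ 2 ∂(gaussianReal m v) = v + m ^ 2 := by
  have hvar := variance_eq_sub (memLp_id_gaussianReal (μ := m) (v := v) 2)
  rw [variance_id_gaussianReal] at hvar
  simp only [Pi.pow_apply, id, integral_id_gaussianReal] at hvar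
  linarith

theorem tendsto_studentT :
    Tendsto (β := ProbabilityMeasure ℝ) (fun n => ⟨studentT n, inferInstance⟩) atTop
      (𝓝 ⟨gaussianReal 0 1, inferInstance⟩) := by
  obtain ⟨Ω, _, P, Z, hmeas, hZ, hindep, _⟩ := exists_iid ℕ (gaussianReal 0 1)
  have hsq : Measurable fun x : ℝ => x ^ 2 := by fun_prop
  have hdenom : ∀ᵐ ω ∂P, Tendsto (fun n => sampleMean fun i : Fin n => Z (i + 1) ω ^ 2) atTop
      (𝓝 1) := by
    have hmean : P[fun ω => Z 1 ω ^ 2] = 1 := by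
      simpa [integral_sq_gaussianReal] using (hZ 1).integral_comp hsq.aestronglyMeasurable
    have hint : Integrable (fun ω => Z 1 ω ^ 2) P :=
      (((hZ 1).identDistrib HasLaw.id).memLp_iff.2 (memLp_id_gaussianReal 2)).integrable_sq
    rw [← hmean]
    exact ae_tendsto_sampleMean (Y := fun i ω => Z (i + 1) ω ^ 2) hint
      (fun i j hij => (hindep.indepFun (by simpa using hij)).comp hsq hsq)
      fun i => ((hZ (i + 1)).identDistrib (hZ 1)).comp hsq
  have hquot : ∀ᵐ ω ∂P, Tendsto
      (fun n => Z 0 ω / √(sampleMean fun i : Fin n => Z (i + 1) ω ^ 2)) atTop (𝓝 (Z 0 ω)) := by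
    filter_upwards [hdenom] with ω hω
    have hlim := (tendsto_const_nhds (x := Z 0 ω)).div hω.sqrt (by simp)
    rwa [Real.sqrt_one, div_one] at hlim
  have hlaw : ∀ n, P.map (fun ω => Z 0 ω / √(sampleMean fun i : Fin n => Z (i + 1) ω ^ 2)) =
      studentT n := fun n =>
    (hasLaw_studentT (Z := fun i => Z i) (fun i => hZ i)
      (hindep.precomp Fin.val_injective)).map_eq
  simpa only [hlaw, (hZ 0).map_eq] using
    (tendstoInDistribution_of_ae_tendsto (fun n => by fun_prop) (by fun_prop) hquot).tendsto

theorem eventually_le_tCritical {α c : ℝ} (hα : 0 < α)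
    (hc : (gaussianReal 0 1).real (Set.Icc (-c) c) < 1 - α) :
    ∀ᶠ n in atTop, c ≤ tCritical n α := by
  filter_upwards [eventually_measureReal_lt_of_tendsto_of_isClosed tendsto_studentT isClosed_Icc
    hc] with n (hn : (studentT n).real (Set.Icc (-c) c) < 1 - α)
  refine le_csInf ?_ fun b ⟨_, hb⟩ => ?_
  · obtain ⟨b, hlt, hb⟩ := (((tendsto_measureReal_Icc_neg_atTop (studentT n)).eventually_const_lt
      (sub_lt_self 1 hα)).and (eventually_ge_atTop 0)).exists
    exact ⟨b, hb, hlt.le⟩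
  · by_contra! hbc
    exact (hb.trans (measureReal_mono (Set.Icc_subset_Icc (neg_le_neg hbc.le) hbc.le))).not_gt hn

end StudentT

section Noncoverage

variable {Ω : Type*} [MeasurableSpace Ω] {P : Measure Ω}

theorem measureReal_lt_lowerConfidenceLimit_eq_zero_of_ae_eq {N : ℕ} (hN : N ≠ 0)
    {Y : Fin N → Ω → ℝ} {m : ℝ} (hY : ∀ i, ∀ᵐ ω ∂P, Y i ω = m) (α : ℝ) :
    P.real {ω | m < lowerConfidenceLimit α fun i => Y i ω} = 0 := by
  rw [measureReal_def, measure_eq_zero_iff_ae_notMem.2, ENNReal.toReal_zero]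
  filter_upwards [ae_all_iff.2 hY] with ω hω
  simp [hω, lowerConfidenceLimit_const hN]

theorem exists_gaussianReal_Icc_neg_lt_and_Ici_lt {α ε : ℝ} (hα₀ : 0 < α) (hα₁ : α < 1)
    (hε : 0 < ε) :
    ∃ c : ℝ, (gaussianReal 0 1).real (Set.Icc (-c) c) < 1 - α ∧
      (gaussianReal 0 1).real (Set.Ici c) < α / 2 + ε := by
  have := nullSingletonClass_gaussianReal (μ := 0) one_ne_zero
  obtain ⟨c, hc₀, hc⟩ := exists_measureReal_Icc_neg_eq (μ := gaussianReal 0 1)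
    (le_max_left 0 (1 - α - ε)) (max_lt one_pos (by linarith))
  refine ⟨c, hc ▸ max_lt (by linarith) (by linarith), ?_⟩
  rw [measureReal_Ici_eq_of_map_neg_eq (by simp [gaussianReal_map_neg]) hc₀, hc]
  linarith [le_max_right 0 (1 - α - ε)]

variable [IsProbabilityMeasure P] {Y : ℕ → Ω → ℝ} {α ε : ℝ}

theorem eventually_measureReal_lt_lowerConfidenceLimit_le_of_variance_ne_zero
    (hL2 : MemLp (Y 0) 2 P) (hindep : iIndepFun Y P)
    (hident : ∀ i, IdentDistrib (Y i) (Y 0) P P) (hvar : Var[Y 0; P] ≠ 0)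
    (hα₀ : 0 < α) (hα₁ : α < 1) (hε : 0 < ε) :
    ∀ᶠ N in atTop,
      P.real {ω | P[Y 0] < lowerConfidenceLimit α fun i : Fin N => Y i ω} ≤ α / 2 + ε := by
  obtain ⟨c, hIcc, hIci⟩ := exists_gaussianReal_Icc_neg_lt_and_Ici_lt hα₀ hα₁ hε
  have hσ : 0 < √(Var[Y 0; P]) := Real.sqrt_pos.2 ((variance_nonneg _ _).lt_of_ne' hvar)
  have hlim := tendstoInDistribution_sqrt_mul_sampleMean_sub_sub_mul_sampleStdDev
    (Z := id) (P' := gaussianReal 0 1) HasLaw.id hL2 hindep hident c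
  have hlimit : ((gaussianReal 0 1).map fun z => √(Var[Y 0; P]) * z - c * √(Var[Y 0; P])).real
      (Set.Ici 0) < α / 2 + ε := by
    rw [map_measureReal_apply (by fun_prop) measurableSet_Ici]
    convert hIci using 2
    ext z
    rw [Set.mem_preimage, Set.mem_Ici, sub_nonneg, mul_comm c, mul_le_mul_iff_right₀ hσ,
      Set.mem_Ici]
  filter_upwards [eventually_measureReal_lt_of_tendsto_of_isClosed hlim.tendsto isClosed_Ici hlimit,
    (tendsto_sub_atTop_nat 1).eventually (eventually_le_tCritical hα₀ hIcc),
    eventually_ne_atTop 0] with N hN hcrit hN₀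
  rw [ProbabilityMeasure.coe_mk, map_measureReal_apply_of_aemeasurable
    (hlim.forall_aemeasurable N) measurableSet_Ici] at hN
  exact (measureReal_mono fun ω hω => sub_nonneg.2
    (mul_sampleStdDev_le_of_lt_lowerConfidenceLimit hN₀ hcrit hω)).trans hN.le

theorem eventually_measureReal_lt_lowerConfidenceLimit_le
    (hL2 : MemLp (Y 0) 2 P) (hindep : iIndepFun Y P)
    (hident : ∀ i, IdentDistrib (Y i) (Y 0) P P) (hα₀ : 0 < α) (hα₁ : α < 1) (hε : 0 < ε) :
    ∀ᶠ N in atTop,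
      P.real {ω | P[Y 0] < lowerConfidenceLimit α fun i : Fin N => Y i ω} ≤ α / 2 + ε := by
  by_cases hvar : Var[Y 0; P] = 0
  · have hconst : ∀ i, ∀ᵐ ω ∂P, Y i ω = P[Y 0] := fun i =>
      (hident i).symm.ae_mem_snd (measurableSet_singleton _)
        (ae_eq_integral_of_variance_eq_zero hL2 hvar)
    filter_upwards [eventually_ne_atTop 0] with N hN
    rw [measureReal_lt_lowerConfidenceLimit_eq_zero_of_ae_eq hN (fun i => hconst i) α]
    positivity
  · exact eventually_measureReal_lt_lowerConfidenceLimit_le_of_variance_ne_zero hL2 hindep hident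
      hvar hα₀ hα₁ hε

end Noncoverage

theorem one_sub_measureReal_not_sub_measureReal_not_le {Ω : Type*} [MeasurableSpace Ω]
    {P : Measure Ω} [IsProbabilityMeasure P] {p q : Ω → Prop} :
    1 - P.real {ω | ¬p ω} - P.real {ω | ¬q ω} ≤ P.real {ω | p ω ∧ q ω} := by
  have hcover : {ω | p ω ∧ q ω} ∪ ({ω | ¬p ω} ∪ {ω | ¬q ω}) = Set.univ :=
    Set.eq_univ_of_forall fun ω => by
      by_cases p ω <;> by_cases q ω <;> simp [*]
  have hunion := (measureReal_union_le {ω | p ω ∧ q ω} ({ω | ¬p ω} ∪ {ω | ¬q ω})).trans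
    (add_le_add_right (measureReal_union_le (μ := P) {ω | ¬p ω} {ω | ¬q ω}) _)
  rw [hcover, probReal_univ] at hunion
  linarith

section FiniteSamples

variable {E : Type*} [MeasurableSpace E] {ρ : Measure E} {f g : E → ℝ}

theorem hasLaw_pi_map_of_iIndepFun {Ω ι : Type*} [MeasurableSpace Ω] [Fintype ι] {P : Measure Ω}
    {ξ : ι → Ω → E} (hf : AEMeasurable f ρ) (hξ : ∀ i, HasLaw (ξ i) ρ P) (hindep : iIndepFun ξ P) :
    HasLaw (fun ω i => f (ξ i ω)) (Measure.pi fun _ => ρ.map f) P :=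
  (hindep.comp₀ (fun _ => f) (fun i => (hξ i).aemeasurable)
    fun i => (hξ i).map_eq.symm ▸ hf).hasLaw_pi fun i => HasLaw.comp ⟨hf, rfl⟩ (hξ i)

variable [IsProbabilityMeasure ρ] {α ε : ℝ}

theorem eventually_forall_measureReal_integral_lt_lowerConfidenceLimit_le
    (hf : MemLp f 2 ρ) (hα₀ : 0 < α) (hα₁ : α < 1) (hε : 0 < ε) :
    ∀ᶠ N in atTop, ∀ {Ω : Type*} [MeasurableSpace Ω] (P : Measure Ω) (ξ : Fin N → Ω → E),
      (∀ i, HasLaw (ξ i) ρ P) → iIndepFun ξ P →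
      P.real {ω | ∫ x, f x ∂ρ < lowerConfidenceLimit α fun i => f (ξ i ω)} ≤ α / 2 + ε := by
  obtain ⟨Ω', _, P', W, -, hW, hWindep, _⟩ := exists_iid ℕ ρ
  have hfW : ∀ i, IdentDistrib (fun ω => f (W i ω)) f P' ρ := fun i =>
    ((hW i).identDistrib HasLaw.id).comp_of_aemeasurable ((hW i).map_eq.symm ▸ hf.aemeasurable)
  have hindep : iIndepFun (fun i ω => f (W i ω)) P' :=
    hWindep.comp₀ (fun _ => f) (fun i => (hW i).aemeasurable)
      fun i => (hW i).map_eq.symm ▸ hf.aemeasurable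
  filter_upwards [eventually_measureReal_lt_lowerConfidenceLimit_le ((hfW 0).memLp_iff.2 hf)
    hindep (fun i => (hfW i).trans (hfW 0).symm) hα₀ hα₁ hε] with N hN Ω _ P ξ hξ hξindep
  rw [(hfW 0).integral_eq] at hN
  have hmeas : MeasurableSet {y : Fin N → ℝ | ∫ x, f x ∂ρ < lowerConfidenceLimit α y} :=
    measurableSet_lt measurable_const (by fun_prop)
  have hlaw := hasLaw_pi_map_of_iIndepFun hf.aemeasurable hξ hξindep
  have hlaw' := hasLaw_pi_map_of_iIndepFun hf.aemeasurable (fun i : Fin N => hW i)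
    (hWindep.precomp Fin.val_injective)
  exact (hlaw.measureReal_eq hmeas).trans_le ((hlaw'.measureReal_eq hmeas).symm.trans_le hN)

theorem eventually_forall_measureReal_upperConfidenceLimit_lt_integral_le
    (hf : MemLp f 2 ρ) (hα₀ : 0 < α) (hα₁ : α < 1) (hε : 0 < ε) :
    ∀ᶠ N in atTop, ∀ {Ω : Type*} [MeasurableSpace Ω] (P : Measure Ω) (ξ : Fin N → Ω → E),
      (∀ i, HasLaw (ξ i) ρ P) → iIndepFun ξ P →
      P.real {ω | upperConfidenceLimit α (fun i => f (ξ i ω)) < ∫ x, f x ∂ρ} ≤ α / 2 + ε := by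
  simpa only [Pi.neg_apply, lowerConfidenceLimit_neg, integral_neg, neg_lt_neg_iff] using
    eventually_forall_measureReal_integral_lt_lowerConfidenceLimit_le hf.neg hα₀ hα₁ hε

theorem eventually_forall_one_sub_sub_le_measureReal_lowerConfidenceLimit_le_and_le
    (hf : MemLp f 2 ρ) (hg : MemLp g 2 ρ) (hα₀ : 0 < α) (hα₁ : α < 1) (hε : 0 < ε) :
    ∀ᶠ N in atTop, ∀ {Ω : Type*} [MeasurableSpace Ω] (P : Measure Ω) (ξ : Fin N → Ω → E),
      (∀ i, HasLaw (ξ i) ρ P) → iIndepFun ξ P →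
      1 - α - ε ≤ P.real {ω |
        lowerConfidenceLimit α (fun i => f (ξ i ω)) ≤ ∫ x, f x ∂ρ ∧
        ∫ x, g x ∂ρ ≤ upperConfidenceLimit α fun i => g (ξ i ω)} := by
  filter_upwards [
    eventually_forall_measureReal_integral_lt_lowerConfidenceLimit_le hf hα₀ hα₁ (half_pos hε),
    eventually_forall_measureReal_upperConfidenceLimit_lt_integral_le hg hα₀ hα₁ (half_pos hε)]
    with N hlower hupper Ω _ P ξ hξ hindep
  have := hindep.isProbabilityMeasure
  have hboth := one_sub_measureReal_not_sub_measureReal_not_le (P := P)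
    (p := fun ω => lowerConfidenceLimit α (fun i => f (ξ i ω)) ≤ ∫ x, f x ∂ρ)
    (q := fun ω => ∫ x, g x ∂ρ ≤ upperConfidenceLimit α fun i => g (ξ i ω))
  simp only [not_le] at hboth
  linarith [hlower P ξ hξ hindep, hupper P ξ hξ hindep]

end FiniteSamples

theorem iIndepFun_prodMk_of_sumElim {Ω ι 𝒳 : Type*} [MeasurableSpace Ω] [MeasurableSpace 𝒳]
    [Finite ι] {P : Measure Ω} {χ χ' : ι → Ω → 𝒳} (hχ : ∀ i, AEMeasurable (χ i) P)
    (hχ' : ∀ i, AEMeasurable (χ' i) P) (hindep : iIndepFun (Sum.elim χ χ') P) :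
    iIndepFun (fun i ω => (χ i ω, χ' i ω)) P := by
  have := Fintype.ofFinite ι
  have := hindep.isProbabilityMeasure
  have hmeas : ∀ j, AEMeasurable (Sum.elim χ χ' j) P := Sum.rec hχ hχ'
  have : ∀ j, IsProbabilityMeasure (P.map (Sum.elim χ χ' j)) := fun j =>
    Measure.isProbabilityMeasure_map (hmeas j)
  have hregroup := (measurePreserving_arrowProdEquivProdArrow 𝒳 𝒳 ι
    (fun i => P.map (Sum.elim χ χ' (.inl i))) fun i => P.map (Sum.elim χ χ' (.inr i))).symm.comp
    (measurePreserving_sumPiEquivProdPi fun j => P.map (Sum.elim χ χ' j))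
  have hpair : ∀ i, HasLaw (fun ω => (χ i ω, χ' i ω)) ((P.map (χ i)).prod (P.map (χ' i))) P :=
    fun i => (hindep.indepFun Sum.inl_ne_inr).hasLaw_prod ⟨hχ i, rfl⟩ ⟨hχ' i, rfl⟩
  exact (iIndepFun_iff_hasLaw_pi_pi hpair).2
    (hregroup.comp_hasLaw (hindep.hasLaw_pi fun j => ⟨hmeas j, rfl⟩))

section Estimators

variable {𝒳 T : Type*} [MeasurableSpace 𝒳] {μ : Measure 𝒳} {θhat : 𝒳 → T → ℝ} {τ : 𝒳 → T}

theorem integral_lowerEstimator_le {t : T} (hlower : Integrable (lowerEstimator θhat τ) μ)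
    (hint : Integrable (fun x => θhat x t) μ) (hτ : ∀ᵐ x ∂μ, θhat x (τ x) ≤ θhat x t) :
    ∫ x, lowerEstimator θhat τ x ∂μ ≤ ∫ x, θhat x t ∂μ :=
  integral_mono_ae hlower hint hτ

theorem le_integral_upperEstimator [IsProbabilityMeasure μ] {m : ℝ} {ν : Measure 𝒳}
    [IsProbabilityMeasure ν]
    (hupper : Integrable (Function.uncurry (upperEstimator θhat τ)) (μ.prod ν))
    (hm : ∀ t, m ≤ ∫ x, θhat x t ∂μ) :
    m ≤ ∫ p, Function.uncurry (upperEstimator θhat τ) p ∂(μ.prod ν) := by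
  rw [integral_prod_symm _ hupper]
  calc m = ∫ _, m ∂ν := by simp
    _ ≤ ∫ x', ∫ x, upperEstimator θhat τ x x' ∂μ ∂ν :=
      integral_mono (integrable_const m) hupper.integral_prod_right fun x' => hm (τ x')

variable [TopologicalSpace T] [TopologicalSpace.MetrizableSpace T] [SecondCountableTopology T]
  [MeasurableSpace T] [OpensMeasurableSpace T]

theorem measurable_uncurry_upperEstimator (hmeas : ∀ t, Measurable fun x => θhat x t)
    (hcont : ∀ x, Continuous (θhat x)) (hτ : Measurable τ) :
    Measurable (Function.uncurry (upperEstimator θhat τ)) :=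
  (measurable_uncurry_of_continuous_of_measurable (u := fun t x => θhat x t) hcont hmeas).comp
    ((hτ.comp measurable_snd).prodMk measurable_fst)

theorem memLp_uncurry_upperEstimator {ρ : Measure (𝒳 × 𝒳)} [IsFiniteMeasure ρ]
    (hmeas : ∀ t, Measurable fun x => θhat x t) (hcont : ∀ x, Continuous (θhat x))
    (hbdd : BddAbove (Set.range fun p : 𝒳 × T => |θhat p.1 p.2|)) (hτ : Measurable τ)
    (q : ENNReal) : MemLp (Function.uncurry (upperEstimator θhat τ)) q ρ := by
  obtain ⟨C, hC⟩ := hbdd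
  exact MemLp.of_bound (measurable_uncurry_upperEstimator hmeas hcont hτ).aestronglyMeasurable C
    (ae_of_all _ fun p => hC ⟨(p.1, τ p.2), rfl⟩)

theorem memLp_lowerEstimator [IsFiniteMeasure μ]
    (hmeas : ∀ t, Measurable fun x => θhat x t) (hcont : ∀ x, Continuous (θhat x))
    (hbdd : BddAbove (Set.range fun p : 𝒳 × T => |θhat p.1 p.2|)) (hτ : Measurable τ)
    (q : ENNReal) : MemLp (lowerEstimator θhat τ) q μ := by
  obtain ⟨C, hC⟩ := hbdd
  exact MemLp.of_bound ((measurable_uncurry_upperEstimator hmeas hcont hτ).comp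
    (measurable_id.prodMk measurable_id)).aestronglyMeasurable C
    (ae_of_all _ fun x => hC ⟨(x, τ x), rfl⟩)

end Estimators

theorem mainTheorem3_general
    {𝒳 T : Type*} [MeasurableSpace 𝒳]
    {Ω₀ : Type*} [MeasurableSpace Ω₀] (P₀ : Measure Ω₀) [IsProbabilityMeasure P₀]
    (X : Ω₀ → 𝒳) (hX : AEMeasurable X P₀)
    (θhat : 𝒳 → T → ℝ)
    (hint : ∀ t, Integrable (fun x => θhat x t) (P₀.map X))
    (θ : T → ℝ) (hunbiased : ∀ t, ∫ ω, θhat (X ω) t ∂P₀ = θ t)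
    (θstar : ℝ) (hθstar : IsLeast (Set.range θ) θstar)
    (τ : 𝒳 → T) (hτ : ∀ t, ∀ᵐ x ∂(P₀.map X), θhat x (τ x) ≤ θhat x t)
    (hlower : MemLp (lowerEstimator θhat τ) 2 (P₀.map X))
    (hupper : MemLp (Function.uncurry (upperEstimator θhat τ)) 2 ((P₀.map X).prod (P₀.map X)))
    (α : ℝ) (hα₀ : 0 < α) (hα₁ : α < 1) :
    ∀ ε : ℝ, 0 < ε → ∃ N₀ : ℕ, ∀ N ≥ N₀,
      ∀ {Ω : Type*} [MeasurableSpace Ω] (P : Measure Ω) [IsProbabilityMeasure P]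
        (χ χ' : Fin N → Ω → 𝒳),
        (∀ i, IdentDistrib (χ i) X P P₀) → (∀ i, IdentDistrib (χ' i) X P P₀) →
        iIndepFun (Sum.elim χ χ') P →
        1 - α - ε ≤
          P.real {ω |
            lowerConfidenceLimit α (fun i => lowerEstimator θhat τ (χ i ω)) ≤ θstar ∧
            θstar ≤ upperConfidenceLimit α
              (fun i => upperEstimator θhat τ (χ i ω) (χ' i ω))} := by
  intro ε hε
  have := Measure.isProbabilityMeasure_map hX
  have hmean : ∀ t, ∫ x, θhat x t ∂(P₀.map X) = θ t := fun t =>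
    (integral_map hX (hint t).aestronglyMeasurable).trans (hunbiased t)
  obtain ⟨⟨t₀, ht₀⟩, hle⟩ := hθstar
  have hlower_le : ∫ p, lowerEstimator θhat τ p.1 ∂((P₀.map X).prod (P₀.map X)) ≤ θstar := by
    rw [integral_fun_fst, probReal_univ, one_smul, ← ht₀, ← hmean]
    exact integral_lowerEstimator_le (hlower.integrable one_le_two) (hint t₀) (hτ t₀)
  have hle_upper := le_integral_upperEstimator (hupper.integrable one_le_two) fun t =>
    (hle ⟨t, rfl⟩).trans_eq (hmean t).symm
  refine eventually_atTop.1 ?_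
  filter_upwards [eventually_forall_one_sub_sub_le_measureReal_lowerConfidenceLimit_le_and_le
    (hlower.comp_fst _) hupper hα₀ hα₁ hε] with N hN Ω _ P _ χ χ' hχ hχ' hindep
  have hpair : ∀ i, HasLaw (fun ω => (χ i ω, χ' i ω)) ((P₀.map X).prod (P₀.map X)) P := fun i =>
    (hindep.indepFun Sum.inl_ne_inr).hasLaw_prod
      ⟨(hχ i).aemeasurable_fst, (hχ i).map_eq⟩ ⟨(hχ' i).aemeasurable_fst, (hχ' i).map_eq⟩
  refine (hN P _ hpair (iIndepFun_prodMk_of_sumElim (fun i => (hχ i).aemeasurable_fst)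
    (fun i => (hχ' i).aemeasurable_fst) hindep)).trans ?_
  exact measureReal_mono fun ω hω => ⟨hω.1.trans hlower_le, hle_upper.trans hω.2⟩

theorem mainTheorem3
    {𝒳 : Type*} [MeasurableSpace 𝒳]
    {k : ℕ} (T : Set (EuclideanSpace ℝ (Fin k))) (hT : IsCompact T)
    {Ω₀ : Type*} [MeasurableSpace Ω₀] (P₀ : Measure Ω₀) [IsProbabilityMeasure P₀]
    (X : Ω₀ → 𝒳) (hX : Measurable X)
    (θhat : 𝒳 → T → ℝ)
    (hmeas : ∀ t, Measurable fun x => θhat x t)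
    (hcont : ∀ x, Continuous (θhat x))
    (hbdd : BddAbove (Set.range fun p : 𝒳 × T => |θhat p.1 p.2|))
    (θ : T → ℝ) (hunbiased : ∀ t, ∫ ω, θhat (X ω) t ∂P₀ = θ t)
    (θstar : ℝ) (hθstar : IsLeast (Set.range θ) θstar)
    (τ : 𝒳 → T) (hτmeas : Measurable τ) (hτ : ∀ x t, θhat x (τ x) ≤ θhat x t)
    (α : ℝ) (hα₀ : 0 < α) (hα₁ : α < 1) :
    ∀ ε : ℝ, 0 < ε → ∃ N₀ : ℕ, ∀ N ≥ N₀,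
      ∀ {Ω : Type*} [MeasurableSpace Ω] (P : Measure Ω) [IsProbabilityMeasure P]
        (χ χ' : Fin N → Ω → 𝒳),
        (∀ i, IdentDistrib (χ i) X P P₀) → (∀ i, IdentDistrib (χ' i) X P P₀) →
        iIndepFun (Sum.elim χ χ') P →
        1 - α - ε ≤
          P.real {ω |
            lowerConfidenceLimit α (fun i => lowerEstimator θhat τ (χ i ω)) ≤ θstar ∧
            θstar ≤ upperConfidenceLimit α
              (fun i => upperEstimator θhat τ (χ i ω) (χ' i ω))} :=
  have := Measure.isProbabilityMeasure_map hX.aemeasurable (μ := P₀)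
  mainTheorem3_general P₀ X hX.aemeasurable θhat
    (fun t => memLp_one_iff_integrable.1
      (memLp_lowerEstimator hmeas hcont hbdd (τ := fun _ => t) measurable_const 1))
    θ hunbiased θstar hθstar τ (fun t => ae_of_all _ fun x => hτ x t)
    (memLp_lowerEstimator hmeas hcont hbdd hτmeas 2)
    (memLp_uncurry_upperEstimator hmeas hcont hbdd hτmeas 2) α hα₀ hα₁
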